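/- Let $T$ be a finite tree of diameter $5$, and let $n$ be its number of edges. Then $T$ is odd-graceful; that is, there is an injection $f : V(T) \to \{0, 1, \dots, 2n-1\}$ such that the set of induced edge weights $\{\, |f(x) - f(y)| : xy \in E(T) \,\}$ is exactly $\{1, 3, 5, \dots, 2n-1\}$. -/

import Mathlib

namespace SimpleGraph

variable {V : Type*}

/-- The size of a (finite) graph: its number of edges. -/
noncomputable def size (G : SimpleGraph V) : ℕ := G.edgeSet.ncard

/-- The set of weights `|f x - f y|` that a vertex labeling `f` induces on the edges `xy` of `G`. -/
def inducedWeights (G : SimpleGraph V) (f : V → ℕ) : Set ℤ :=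
  {w | ∃ x y : V, G.Adj x y ∧ w = |(f x : ℤ) - (f y : ℤ)|}

/-- `f` is an odd-graceful labeling of the finite graph `G` of size `n`: it is an injection from
the vertices to `{0, 1, ..., 2n - 1}` and the set of induced weights is `{1, 3, ..., 2n - 1}`. -/
def IsOddGracefulLabeling (G : SimpleGraph V) (f : V → ℕ) : Prop :=
  Function.Injective f ∧
    (∀ v, f v < 2 * G.size) ∧
    G.inducedWeights f = {w : ℤ | ∃ i : ℕ, i < G.size ∧ w = 2 * (i : ℤ) + 1}

/-- A finite graph is odd-graceful if it has an odd-graceful labeling. -/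
def IsOddGraceful (G : SimpleGraph V) : Prop :=
  ∃ f : V → ℕ, G.IsOddGracefulLabeling f

end SimpleGraph

/-! ### Distances in a tree and the central edge -/

namespace SimpleGraph

/-! The middle edge `uv` of a longest path has depth at most 2 on each side
(`IsTree.exists_central_edge`), so the tree is given by the children of `u` and of `v` and the
leaves below them. An explicit labeling then works: even and odd labels alternate along edges, and
each kind of edge receives a block of consecutive odd weights. Within a row of leaves the weights
fall by 2 from leaf to leaf; ordering the leaves by parent makes their labels strictly monotone,
hence distinct (`label_injective`). The blocks fit together to give every odd weight
(`abs_label_sub_label_parent`, `exists_edgeIndex_eq`). -/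

theorem Connected.exists_adj_dist_eq {V : Type*} {G : SimpleGraph V} (hG : G.Connected) {a b : V}
    {k : ℕ} (h : G.dist a b = k + 1) : ∃ c, G.Adj c b ∧ G.dist a c = k := by
  obtain ⟨p, hp⟩ := hG.exists_walk_length_eq_dist b a
  rw [dist_comm, h] at hp
  cases p with
  | nil => simp at hp
  | @cons _ c _ hadj p =>
    refine ⟨c, hadj.symm, ?_⟩
    have h1 := dist_le p
    have h2 : G.dist a b ≤ G.dist a c + G.dist c b := hG.dist_triangle
    rw [dist_eq_one_iff_adj.2 hadj.symm] at h2
    rw [dist_comm] at h1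
    simp only [Walk.length_cons] at hp
    omega

/-- Geodesics to `b` and to `c`, prolonged to `x`, are still geodesics, hence paths; a tree has only
one path from `a` to `x`. -/
theorem IsTree.eq_of_adj_of_dist_eq {V : Type*} {G : SimpleGraph V} (hG : G.IsTree) {a b c x : V}
    (hb : G.Adj b x) (hc : G.Adj c x) (hbx : G.dist a x = G.dist a b + 1)
    (hcx : G.dist a x = G.dist a c + 1) : b = c := by
  obtain ⟨p, hp⟩ := hG.connected.exists_walk_length_eq_dist a b
  obtain ⟨q, hq⟩ := hG.connected.exists_walk_length_eq_dist a c
  have hp' : (p.concat hb).IsPath := Walk.isPath_of_length_eq_dist _ (by simp; omega)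
  have hq' : (q.concat hc).IsPath := Walk.isPath_of_length_eq_dist _ (by simp; omega)
  obtain ⟨h, -⟩ := Walk.concat_inj ((hG.existsUnique_path a x).unique hp' hq')
  exact h

/-- The vertices `a` and `b` lie on opposite sides of the edge `uv`, so the path between them
crosses it. The induction moves `b` away from `v`. -/
theorem IsTree.dist_eq_add_of_adj {V : Type*} {G : SimpleGraph V} (hG : G.IsTree) {u v : V}
    (huv : G.Adj u v) {a b : V} (ha : G.dist a v = G.dist a u + 1)
    (hb : G.dist u b = G.dist v b + 1) : G.dist a b = G.dist a v + G.dist v b := by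
  obtain ⟨k, hk⟩ : ∃ k, G.dist v b = k := ⟨_, rfl⟩
  induction k using Nat.strong_induction_on generalizing b with
  | _ k ih =>
    cases k with
    | zero =>
      have : v = b := hG.connected.dist_eq_zero_iff.1 hk
      subst this
      simp
    | succ k =>
      have parent : ∀ {b : V} {k : ℕ}, G.dist u b = G.dist v b + 1 → G.dist v b = k + 1 →
          ∃ c, G.Adj c b ∧ G.dist v c = k ∧ G.dist u c = G.dist v c + 1 := by
        intro b k hb hk
        obtain ⟨c, hcb, hc⟩ := hG.connected.exists_adj_dist_eq hk
        have h1 : G.dist u b ≤ G.dist u c + G.dist c b := hG.connected.dist_triangle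
        have h2 : G.dist u c ≤ G.dist u v + G.dist v c := hG.connected.dist_triangle
        rw [dist_eq_one_iff_adj.2 hcb] at h1
        rw [dist_eq_one_iff_adj.2 huv] at h2
        exact ⟨c, hcb, hc, by omega⟩
      obtain ⟨c, hcb, hc, hcu⟩ := parent hb hk
      have hac := ih k (by omega) hcu hc
      rcases hG.dist_eq_dist_add_one_of_adj a hcb with h | h
      -- If `b` were nearer to `a` than `c` is, it would be the unique such neighbour of `c`. That
      -- neighbour is `u` when `c = v`, and otherwise the predecessor `c'` of `c` on the way from
      -- `v`; both are impossible.
      · cases k with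
        | zero =>
          have hvc : v = c := hG.connected.dist_eq_zero_iff.1 hc
          subst hvc
          have hbu := hG.eq_of_adj_of_dist_eq huv hcb.symm ha h
          subst hbu
          simp at hb
        | succ k =>
          obtain ⟨c', hcc', hc', hcu'⟩ := parent hcu hc
          have hac' := ih k (by omega) hcu' hc'
          have := hG.eq_of_adj_of_dist_eq hcb.symm hcc' h (by omega)
          subst this
          omega
      · omega

/-- A tree of diameter `5` has a central edge: every vertex is within distance `2` of it. -/
theorem IsTree.exists_central_edge {V : Type*} [Finite V] {G : SimpleGraph V} (hG : G.IsTree)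
    (hd : G.diam = 5) : ∃ u v, G.Adj u v ∧
      (∀ x, G.dist v x = G.dist u x + 1 → G.dist u x ≤ 2) ∧
      (∀ x, G.dist u x = G.dist v x + 1 → G.dist v x ≤ 2) := by
  have := hG.connected.nonempty
  have htop : G.ediam ≠ ⊤ := ediam_ne_top_of_diam_ne_zero (by omega)
  obtain ⟨a, b, hab⟩ := G.exists_dist_eq_diam
  rw [hd] at hab
  obtain ⟨w, hwb, hw⟩ := hG.connected.exists_adj_dist_eq hab
  obtain ⟨v, hvw, hv⟩ := hG.connected.exists_adj_dist_eq hw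
  obtain ⟨u, huv, hu⟩ := hG.connected.exists_adj_dist_eq hv
  have hvb : G.dist v b ≤ G.dist v w + G.dist w b := hG.connected.dist_triangle
  rw [dist_eq_one_iff_adj.2 hvw, dist_eq_one_iff_adj.2 hwb] at hvb
  have h1 : G.dist a b ≤ G.dist a v + G.dist v b := hG.connected.dist_triangle
  have h2 : G.dist a b ≤ G.dist a u + G.dist u b := hG.connected.dist_triangle
  have hub := hG.dist_eq_dist_add_one_of_adj b huv
  simp only [dist_comm (u := b)] at hub
  refine ⟨u, v, huv, fun x hx => ?_, fun x hx => ?_⟩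
  -- A deeper `x` on the side of `u` would be too far from `b`, as `v` is at distance 2 from `b`; on
  -- the other side `a` plays this role, at distance 3 from `v`.
  · have h3 := hG.dist_eq_add_of_adj huv (a := x) (b := b)
      (by simpa only [dist_comm (u := x)] using hx) (by omega)
    have h4 : G.dist x b ≤ G.diam := dist_le_diam htop
    rw [dist_comm (u := x) (v := v)] at h3
    omega
  · have h3 := hG.dist_eq_add_of_adj huv (a := a) (b := x) (by omega) hx
    have h4 : G.dist a x ≤ G.diam := dist_le_diam htop
    omega

end SimpleGraph

/-- A finite set can be enumerated so that a given key is monotone. -/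
theorem Finset.exists_monotone_enumeration {α : Type*} (s : Finset α) (key : α → ℕ) :
    ∃ e : Fin s.card → α, Function.Injective e ∧ (∀ x, x ∈ s ↔ ∃ i, e i = x) ∧
      Monotone fun i => key (e i) := by
  let e : Fin s.card → α := fun i => (s.equivFin.symm i : α)
  refine ⟨e ∘ Tuple.sort (key ∘ e), ?_, fun x => ?_, Tuple.monotone_sort (key ∘ e)⟩
  · exact (Subtype.val_injective.comp s.equivFin.symm.injective).comp (Equiv.injective _)
  · constructor
    · intro hx
      exact ⟨(Tuple.sort (key ∘ e)).symm (s.equivFin ⟨x, hx⟩), by simp [e]⟩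
    · rintro ⟨i, rfl⟩
      exact (s.equivFin.symm _).2

/-! ### Enumerating one side of the central edge -/

namespace SimpleGraph

/-- The part of a tree on the side of `u` of an edge `uv`, if it has depth at most `2`: `c`
enumerates the neighbours of `u`, and `l` the vertices at distance `2`, sorted by their parents. -/
theorem IsTree.exists_side_enumeration {V : Type*} [Finite V] {G : SimpleGraph V} (hG : G.IsTree)
    {u v : V} (huv : G.Adj u v) :
    ∃ (p m : ℕ) (c : Fin p → V) (l : Fin m → V) (k : Fin m → Fin p),
      Function.Injective c ∧ Function.Injective l ∧ Monotone k ∧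
      (∀ x, G.dist u x = 1 ∧ G.dist v x = 2 ↔ ∃ i, c i = x) ∧
      (∀ x, G.dist u x = 2 ∧ G.dist v x = 3 ↔ ∃ j, l j = x) ∧
      ∀ i j, G.Adj (c i) (l j) ↔ i = k j := by
  classical
  have := Fintype.ofFinite V
  obtain ⟨c, hc, hcm, -⟩ := Finset.exists_monotone_enumeration
    {x : V | G.dist u x = 1 ∧ G.dist v x = 2} fun _ => 0
  simp only [Finset.mem_filter_univ] at hcm
  have hpar : ∀ x, G.dist u x = 2 ∧ G.dist v x = 3 → ∃ i, G.Adj (c i) x := by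
    rintro x ⟨hux, hvx⟩
    obtain ⟨y, hyx, hy⟩ := hG.connected.exists_adj_dist_eq hux
    have h1 : G.dist v x ≤ G.dist v y + G.dist y x := hG.connected.dist_triangle
    have h2 : G.dist v y ≤ G.dist v u + G.dist u y := hG.connected.dist_triangle
    rw [dist_eq_one_iff_adj.2 hyx] at h1
    rw [dist_eq_one_iff_adj.2 huv.symm] at h2
    obtain ⟨i, rfl⟩ := (hcm y).1 ⟨hy, by omega⟩
    exact ⟨i, hyx⟩
  -- The key is the index of the parent; by `hpar` the default 0 is never taken on this set.
  obtain ⟨l, hl, hlm, hmono⟩ := Finset.exists_monotone_enumeration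
    {x : V | G.dist u x = 2 ∧ G.dist v x = 3}
    fun x => if h : ∃ i, G.Adj (c i) x then (h.choose : ℕ) else 0
  simp only [Finset.mem_filter_univ] at hlm
  have hl' : ∀ j, ∃ i, G.Adj (c i) (l j) := fun j => hpar _ ((hlm _).2 ⟨j, rfl⟩)
  refine ⟨_, _, c, l, fun j => (hl' j).choose, hc, hl, fun i j hij => ?_, hcm, hlm,
    fun i j => ⟨fun h => ?_, ?_⟩⟩
  · have := hmono hij
    simpa only [dif_pos (hl' _), Fin.val_fin_le] using this
  · have h1 := (hcm _).2 ⟨i, rfl⟩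
    have h2 := (hcm (c (hl' j).choose)).2 ⟨_, rfl⟩
    have h3 := (hlm _).2 ⟨j, rfl⟩
    exact hc (hG.eq_of_adj_of_dist_eq (a := u) h (hl' j).choose_spec (by omega)
      (by rw [h3.1, h2.1]))
  · rintro rfl
    exact (hl' j).choose_spec

end SimpleGraph

/-- Vertices of a tree of diameter at most `5`: the ends `u`, `v` of a central edge, the other
neighbours `c` of `u` and `d` of `v`, and the leaves `lc`, `ld` below these. -/
inductive CentralEdgeVertex (p m q r : ℕ) : Type
  | u | v
  | c (i : Fin p) | lc (j : Fin m)
  | d (i : Fin q) | ld (j : Fin r)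

/-! ### The labeling of the explicit model -/

namespace CentralEdgeVertex

variable {p m q r : ℕ}

/-- The vertices in terms of standard finite types. -/
def equivSum (p m q r : ℕ) :
    CentralEdgeVertex p m q r ≃ (Bool ⊕ Fin p ⊕ Fin m ⊕ Fin q ⊕ Fin r) where
  toFun
    | u => .inl true
    | v => .inl false
    | c i => .inr (.inl i)
    | lc j => .inr (.inr (.inl j))
    | d i => .inr (.inr (.inr (.inl i)))
    | ld j => .inr (.inr (.inr (.inr j)))
  invFun
    | .inl true => u
    | .inl false => v
    | .inr (.inl i) => c i
    | .inr (.inr (.inl j)) => lc j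
    | .inr (.inr (.inr (.inl i))) => d i
    | .inr (.inr (.inr (.inr j))) => ld j
  left_inv x := by cases x <;> rfl
  right_inv x := by rcases x with (_ | _) | _ | _ | _ | _ <;> rfl

theorem card_eq (p m q r : ℕ) :
    Nat.card (CentralEdgeVertex p m q r) = 2 + p + m + q + r := by
  rw [Nat.card_congr (equivSum p m q r)]
  simp
  omega

/-- The neighbour closer to `u`; the root `u` itself is mapped to `u`. -/
def parent (k : Fin m → Fin p) (k' : Fin r → Fin q) :
    CentralEdgeVertex p m q r → CentralEdgeVertex p m q r
  | u => u
  | v => u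
  | c _ => u
  | lc j => c (k j)
  | d _ => v
  | ld j => d (k' j)

/-- The odd-graceful labeling: the vertices `u`, `lc`, `d` have even labels. -/
def label (k : Fin m → Fin p) (k' : Fin r → Fin q) : CentralEdgeVertex p m q r → ℕ
  | u => 0
  | v => 2 * (m + q + r) + 1
  | c i => 2 * (m + q + r + 1 + i) + 1
  | lc j => 2 * (q + 2 + k j + j)
  | d i => 2 * (q - i)
  | ld j => 2 * ((q - k' j) + (r - 1 - j)) + 1

/-- Even labels: `u` is 0, the `d` fill 2 to `2 * q`, and the `lc` lie above. Odd labels: the `ld`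
lie below `v`, the `c` above. Monotonicity of `k` and `k'` makes the `lc` strictly increasing and
the `ld` strictly decreasing. -/
theorem label_injective {k : Fin m → Fin p} {k' : Fin r → Fin q} (hk : Monotone k)
    (hk' : Monotone k') : Function.Injective (label k k') := by
  intro x y h
  cases x <;> cases y <;> simp only [label] at h <;> try omega
  all_goals first | rfl | skip
  case c.c i j => exact congrArg c (by omega)
  case d.d i j => exact congrArg d (by omega)
  case lc.lc i j =>
    rcases lt_trichotomy i j with hij | rfl | hij
    · have := hk hij.le
      simp only [Fin.lt_def, Fin.le_def] at *
      omega
    · rfl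
    · have := hk hij.le
      simp only [Fin.lt_def, Fin.le_def] at *
      omega
  case ld.ld i j =>
    rcases lt_trichotomy i j with hij | rfl | hij
    · have := hk' hij.le
      simp only [Fin.lt_def, Fin.le_def] at *
      omega
    · rfl
    · have := hk' hij.le
      simp only [Fin.lt_def, Fin.le_def] at *
      omega

theorem label_lt (k : Fin m → Fin p) (k' : Fin r → Fin q) (x : CentralEdgeVertex p m q r) :
    label k k' x < 2 * (1 + p + m + q + r) := by
  cases x <;> simp only [label] <;> omega

/-- The weight of the edge from `x ≠ u` to its parent is `2 * edgeIndex x + 1`. -/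
def edgeIndex : CentralEdgeVertex p m q r → ℕ
  | u => 0
  | v => m + q + r
  | c i => m + q + r + 1 + i
  | lc j => m + r - 1 - j
  | d i => m + r + i
  | ld j => r - 1 - j

theorem edgeIndex_lt (x : CentralEdgeVertex p m q r) : edgeIndex x < 1 + p + m + q + r := by
  cases x <;> simp only [edgeIndex] <;> omega

/-- For `lc` and `ld` the parent's index occurs in both labels and cancels, so the weight depends
only on the position of the leaf. -/
theorem abs_label_sub_label_parent (k : Fin m → Fin p) (k' : Fin r → Fin q)
    {x : CentralEdgeVertex p m q r} (hx : x ≠ u) :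
    |(label k k' x : ℤ) - label k k' (parent k k' x)| = 2 * (edgeIndex x : ℤ) + 1 := by
  cases x with
  | u => exact absurd rfl hx
  | v => simp only [label, parent, edgeIndex]; rw [abs_eq (by omega)]; omega
  | c i => simp only [label, parent, edgeIndex]; rw [abs_eq (by omega)]; omega
  | lc j => simp only [label, parent, edgeIndex]; rw [abs_eq (by omega)]; omega
  | d i => simp only [label, parent, edgeIndex]; rw [abs_eq (by omega)]; omega
  | ld j => simp only [label, parent, edgeIndex]; rw [abs_eq (by omega)]; omega

/-- The indices of `ld`, `lc`, `d`, `v`, `c` fill consecutive intervals of lengths `r`, `m`, `q`, 1,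
`p`, in this order. -/
theorem exists_edgeIndex_eq {i : ℕ} (hi : i < 1 + p + m + q + r) :
    ∃ x : CentralEdgeVertex p m q r, x ≠ u ∧ edgeIndex x = i := by
  by_cases h1 : i < r
  · exact ⟨ld ⟨r - 1 - i, by omega⟩, by simp, by simp only [edgeIndex]; omega⟩
  by_cases h2 : i < m + r
  · exact ⟨lc ⟨m + r - 1 - i, by omega⟩, by simp, by simp only [edgeIndex]; omega⟩
  by_cases h3 : i < m + q + r
  · exact ⟨d ⟨i - (m + r), by omega⟩, by simp, by simp only [edgeIndex]; omega⟩
  by_cases h4 : i = m + q + r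
  · exact ⟨v, by simp, by simp only [edgeIndex]; omega⟩
  · exact ⟨c ⟨i - (m + q + r + 1), by omega⟩, by simp, by simp only [edgeIndex]; omega⟩

/-- A graph with a parametrization of its vertices under which the edges are exactly the pairs of
a vertex and its parent is odd-graceful. -/
theorem isOddGraceful {V : Type*} {G : SimpleGraph V} {k : Fin m → Fin p} {k' : Fin r → Fin q}
    (hk : Monotone k) (hk' : Monotone k') (e : CentralEdgeVertex p m q r ≃ V)
    (hsize : G.size = 1 + p + m + q + r)
    (hadj : ∀ x, x ≠ u → G.Adj (e x) (e (parent k k' x)))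
    (hex : ∀ x y, G.Adj (e x) (e y) → (x ≠ u ∧ parent k k' x = y) ∨ (y ≠ u ∧ parent k k' y = x)) :
    G.IsOddGraceful := by
  refine ⟨fun w => label k k' (e.symm w), (label_injective hk hk').comp e.symm.injective,
    fun w => hsize ▸ label_lt k k' _, ?_⟩
  ext w
  simp only [SimpleGraph.inducedWeights, Set.mem_ofPred_eq, hsize]
  constructor
  · rintro ⟨a, b, hab, rfl⟩
    obtain ⟨x, rfl⟩ := e.surjective a
    obtain ⟨y, rfl⟩ := e.surjective b
    simp only [Equiv.symm_apply_apply]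
    rcases hex x y hab with ⟨hx, rfl⟩ | ⟨hy, rfl⟩
    · exact ⟨edgeIndex x, edgeIndex_lt x, abs_label_sub_label_parent k k' hx⟩
    · rw [abs_sub_comm]
      exact ⟨edgeIndex y, edgeIndex_lt y, abs_label_sub_label_parent k k' hy⟩
  · rintro ⟨i, hi, rfl⟩
    obtain ⟨x, hx, rfl⟩ := exists_edgeIndex_eq hi
    refine ⟨_, _, hadj x hx, ?_⟩
    simp only [Equiv.symm_apply_apply]
    exact (abs_label_sub_label_parent k k' hx).symm

end CentralEdgeVertex

/-! ### Identifying the tree with the model -/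

theorem SimpleGraph.IsTree.size_add_one {V : Type*} [Finite V] {G : SimpleGraph V}
    (hG : G.IsTree) : G.size + 1 = Nat.card V := by
  classical
  have := Fintype.ofFinite V
  rw [SimpleGraph.size, ← SimpleGraph.coe_edgeFinset, Set.ncard_coe_finset, hG.card_edgeFinset,
    Nat.card_eq_fintype_card]

open CentralEdgeVertex in
theorem mainTheorem1 {V : Type*} [Finite V] (T : SimpleGraph V) (hT : T.IsTree)
    (hd : T.diam = 5) : T.IsOddGraceful := by
  obtain ⟨a, b, hab, ha, hb⟩ := hT.exists_central_edge hd
  obtain ⟨p, m, c', l', k, hc, hl, hk, hcm, hlm, hcl⟩ := hT.exists_side_enumeration hab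
  obtain ⟨q, r, d', t', k', hd', ht, hk', hdm, htm, hdt⟩ := hT.exists_side_enumeration hab.symm
  have hab1 : T.dist a b = 1 := SimpleGraph.dist_eq_one_iff_adj.2 hab
  have hba1 : T.dist b a = 1 := SimpleGraph.dist_eq_one_iff_adj.2 hab.symm
  have hc2 := fun i => (hcm _).2 ⟨i, rfl⟩
  have hl2 := fun i => (hlm _).2 ⟨i, rfl⟩
  have hd2 := fun i => (hdm _).2 ⟨i, rfl⟩
  have ht2 := fun i => (htm _).2 ⟨i, rfl⟩
  let g : CentralEdgeVertex p m q r → V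
    | u => a
    | v => b
    | c i => c' i
    | lc j => l' j
    | d i => d' i
    | ld j => t' j
  -- The distances `da` to `a` and `db` to `b` together determine the kind of a vertex, so
  -- injectivity of `g` need only be checked within each kind.
  let da : CentralEdgeVertex p m q r → ℕ
    | u => 0
    | v => 1
    | c _ => 1
    | lc _ => 2
    | d _ => 2
    | ld _ => 3
  let db : CentralEdgeVertex p m q r → ℕ
    | u => 1
    | v => 0
    | c _ => 2
    | lc _ => 3
    | d _ => 1
    | ld _ => 2
  have hda : ∀ x, T.dist a (g x) = da x := by
    rintro (_ | _ | i | j | i | j)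
    exacts [SimpleGraph.dist_self, hab1, (hc2 i).1, (hl2 j).1, (hd2 i).2, (ht2 j).2]
  have hdb : ∀ x, T.dist b (g x) = db x := by
    rintro (_ | _ | i | j | i | j)
    exacts [hba1, SimpleGraph.dist_self, (hc2 i).2, (hl2 j).2, (hd2 i).1, (ht2 j).1]
  have hinj : Function.Injective g := by
    intro x y hxy
    have h1 : da x = da y := by rw [← hda, ← hda, hxy]
    have h2 : db x = db y := by rw [← hdb, ← hdb, hxy]
    cases x <;> cases y <;> simp only [da, db] at h1 h2 <;> try omega
    exacts [rfl, rfl, congrArg _ (hc hxy), congrArg _ (hl hxy), congrArg _ (hd' hxy),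
      congrArg _ (ht hxy)]
  have hsurj : Function.Surjective g := by
    intro x
    have hx := hT.dist_eq_dist_add_one_of_adj x hab
    simp only [SimpleGraph.dist_comm (u := x)] at hx
    rcases hx with hx | hx
    · have h2 := hb x hx
      interval_cases h : T.dist b x
      · exact ⟨v, hT.connected.dist_eq_zero_iff.1 h⟩
      · obtain ⟨i, rfl⟩ := (hdm x).1 ⟨h, hx⟩
        exact ⟨d i, rfl⟩
      · obtain ⟨i, rfl⟩ := (htm x).1 ⟨h, hx⟩
        exact ⟨ld i, rfl⟩
    · have h2 := ha x hx
      interval_cases h : T.dist a x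
      · exact ⟨u, hT.connected.dist_eq_zero_iff.1 h⟩
      · obtain ⟨i, rfl⟩ := (hcm x).1 ⟨h, hx⟩
        exact ⟨c i, rfl⟩
      · obtain ⟨i, rfl⟩ := (hlm x).1 ⟨h, hx⟩
        exact ⟨lc i, rfl⟩
  have hcard := Nat.card_congr (Equiv.ofBijective g ⟨hinj, hsurj⟩)
  rw [card_eq, ← hT.size_add_one] at hcard
  have hadj : ∀ x, x ≠ u → T.Adj (g x) (g (parent k k' x)) := by
    rintro (_ | _ | i | j | i | j) hx
    · exact absurd rfl hx
    · exact hab.symm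
    · exact (SimpleGraph.dist_eq_one_iff_adj.1 (hc2 i).1).symm
    · exact ((hcl _ j).2 rfl).symm
    · exact (SimpleGraph.dist_eq_one_iff_adj.1 (hd2 i).1).symm
    · exact ((hdt _ j).2 rfl).symm
  refine CentralEdgeVertex.isOddGraceful hk hk' (Equiv.ofBijective g ⟨hinj, hsurj⟩) (by omega)
    hadj fun x y hxy => ?_
  change T.Adj (g x) (g y) at hxy
  -- With `a` as root, the end of an edge farther from `a` has only one neighbour closer to `a`, and
  -- its parent is such a neighbour.
  have hpar : ∀ {x y}, T.Adj (g x) (g y) → da x = da y + 1 → x ≠ u ∧ parent k k' x = y := by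
    intro x y hxy h
    have hx : x ≠ u := by
      rintro rfl
      simp [da] at h
    refine ⟨hx, hinj (hT.eq_of_adj_of_dist_eq (a := a) (hadj x hx).symm hxy.symm ?_ ?_)⟩
    · rw [hda, hda]
      cases x <;> first | rfl | exact absurd rfl hx
    · rw [hda, hda, h]
  have h1 := hT.dist_eq_dist_add_one_of_adj a hxy
  rw [hda, hda] at h1
  exact h1.imp (hpar hxy) (hpar hxy.symm)
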